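/- Consider the problem (SLBQP) of minimizing $f(x)=\tfrac12x^THx-c^Tx$ over $\Omega=\{x\in\mathbb R^n: q^Tx=b,\ l\le x\le u\}$, where $H=H^T$, $l_i\in\mathbb R\cup\{-\infty\}$, $u_i\in\mathbb R\cup\{+\infty\}$ and $l_i<u_i$. **Notation.** For $x\in\Omega$ let $\mathcal A_l(x)=\{i:x_i=l_i\}$, $\mathcal A_u(x)=\{i:x_i=u_i\}$, $\mathcal A(x)=\mathcal A_l(x)\cup\mathcal A_u(x)$ and $\mathcal F=\mathcal F(x)$ the complement of $\mathcal A(x)$; equality of active sets at two points means equality of both $\mathcal A_l$ and $\mathcal A_u$. Let $\Omega(x)=\{v: q^Tv=b,\ v_i=x_i\ \forall i\in\mathcal A(x)\}$ and $\Omega_0(x)=\{v: q^Tv=0,\ v_i=0\ \forall i\in\mathcal A(x)\}$. Let $P_S$ be the Euclidean projection onto $S$. Let $\nabla_\Omega f(x)=P_{T(x)}(-\nabla f(x))$, where $T(x)=\{v:q^Tv=0,\ v_i\ge0\ \forall i\in\mathcal A_l(x),\ v_i\le 0\ \forall i\in\mathcal A_u(x)\}$. Let $\rho(x)=q_{\mathcal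 F}^T\nabla f_{\mathcal F}(x)/q_{\mathcal F}^Tq_{\mathcal F}$ if $q_{\mathcal F}\neq0$, and $\rho(x)=0$ otherwise. The free gradient $\varphi(x)$ has entries $\nabla f_i(x)-\rho(x)q_i$ for $i\in\mathcal F$ and $0$ for $i\in\mathcal A(x)$; the chopped gradient is $\beta(x)=-\nabla_\Omega f(x)-\varphi(x)$. **The P2GP method.** Parameters: $tol\ge0$, $\eta,\mu_1,\mu_2\in(0,1)$, $\Gamma,\gamma_1,\gamma_2,\gamma_3>0$. Start at $x^0\in\Omega$. As soon as an iterate satisfies $\|\varphi(x^k)+\beta(x^k)\|\le tol$ (this includes $x^0$), the method stops; otherwise it starts an identification phase with $m=0$. After a stop the last iterate is repeated, so that $x^k$ is defined for all $k$. *Identification phase* (begun at iteration $m$). If $\nabla_\Omega f(x^k)^TH\nabla_\Omega f(x^k)\le0$ and the steps $\alpha>0$ with $x^k+\alpha\nabla_\Omega f(x^k)\in\Omega$ are unbounded, stop with "unbounded". Otherwise $x^{k+1}=x^k(\alpha^k)$, where $x^k(\alpha)=P_\Omega(x^k-\alpha\nabla f(x^k))$ and $\alpha^k$ is such that $f(x^{k+1})\le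 f(x^k)+\mu_1\nabla f(x^k)^T(x^{k+1}-x^k)$, $\alpha^k\le\gamma_1$, and either $\alpha^k\ge\gamma_2$ or $\alpha^k\ge\gamma_3\bar\alpha^k>0$ for some $\bar\alpha^k$ with $f(x^k(\bar\alpha^k))>f(x^k)+\mu_2\nabla f(x^k)^T(x^k(\bar\alpha^k)-x^k)$. If the method does not stop at $x^{k+1}$, the phase goes on if $\mathcal A(x^{k+1})\ne\mathcal A(x^k)$ and $f(x^k)-f(x^{k+1})>\eta\,(f(x^j)-f(x^{j+1}))$ for all $m\le j<k$; otherwise a minimization phase follows. *Minimization phase.* Compute an approximate solution $d^k\in\Omega_0(x^k)$ of $\min\{f(x^k+d):d\in\Omega_0(x^k)\}$. If $(d^k)^THd^k\le0$: when $d^k\ne0$ and the steps $\alpha>0$ with $x^k+\alpha d^k\in\Omega$ are unbounded, stop with "unbounded"; otherwise set $x^{k+1}=x^k+\alpha^kd^k$ with $\alpha^k$ the largest such step (so $x^{k+1}=x^k$ if $d^k=0$) and, unless the method stops, begin an identification phase with $m=k+1$. If $(d^k)^THd^k>0$: set $x^{k+1}=x^k+d^k$ if this point is in $\Omega$, and otherwise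 $x^{k+1}=P_{\Omega\cap\Omega(x^k)}(x^k+\alpha^kd^k)$ for some $\alpha^k>0$; in both cases $f(x^{k+1})<f(x^k)$ is required. Unless the method stops at $x^{k+1}$, the minimization phase goes on if $\|\beta(x^{k+1})\|_\infty\le\Gamma\|\varphi(x^{k+1})\|_2$; otherwise an identification phase with $m=k+1$ begins. **Theorem.** Let $f$ be strictly convex on $\{x:q^Tx=b\}$ and let $x^*$ be the optimal solution of (SLBQP). Let $\{x^k\}$ be generated by P2GP with $tol=0$, where the algorithm used in the minimization phase is exact for strictly convex quadratic programming (whenever the reduced problem $\min\{f(x^k+d):d\in\Omega_0(x^k)\}$ is strictly convex, $d^k$ is its exact solution). Assume that, unless the method stops, the set of iterations $k$ belonging to identification phases (GP iterations) is infinite. Suppose that one of the following holds: (i) $x^*$ is nondegenerate, i.e. there are $\rho^*\in\mathbb R$ and $\lambda^*\in\mathbb R^n$ with $\nabla f(x^*)=\lambda^*+\rho^*q$, $\lambda_i^*=0$ for $i\notin\mathcal A(x^*)$, $\lambda^*_i>0$ for $i\in\mathcal A_l(x^*)$ and $\lambda_i^*<0$ for $i\in\mathcal A_u(x^*)$; (ii)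 $x^*$ is degenerate (not nondegenerate) and $\Gamma\ge\kappa(H_q)^{1/2}$, where $H_q=V^THV$, the columns of $V$ form an orthonormal basis of $\{q\}^\perp$, and $\kappa$ is the spectral condition number. Then $x^k=x^*$ for all $k$ sufficiently large. -/

import Mathlib

open scoped Matrix

noncomputable section

/-- Orthogonal (nearest-point) projection of `y` onto a set `S`. -/
def metricProj {E : Type*} [NormedAddCommGroup E] (S : Set E) (y : E) : E :=
  Classical.epsilon fun p => p ∈ S ∧ ∀ z ∈ S, ‖p - y‖ ≤ ‖z - y‖

/-- On a nonempty closed convex set of a Hilbert space the nearest point exists, so that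
`metricProj` is a genuine projection. -/
theorem metricProj_spec {E : Type*} [NormedAddCommGroup E] [InnerProductSpace ℝ E]
    [CompleteSpace E] {S : Set E} (hne : S.Nonempty) (hcl : IsClosed S) (hcv : Convex ℝ S)
    (y : E) :
    metricProj S y ∈ S ∧ ∀ z ∈ S, ‖metricProj S y - y‖ ≤ ‖z - y‖ := by
  obtain ⟨p, hp, hmin⟩ := exists_norm_eq_iInf_of_complete_convex hne hcl.isComplete hcv y
  refine Classical.epsilon_spec (p := fun p => p ∈ S ∧ ∀ z ∈ S, ‖p - y‖ ≤ ‖z - y‖)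
    ⟨p, hp, fun z hz => ?_⟩
  rw [norm_sub_rev p y, norm_sub_rev z y, hmin]
  exact ciInf_le (f := fun w : S => ‖y - w‖)
    ⟨0, by rintro _ ⟨w, rfl⟩; exact norm_nonneg _⟩ ⟨z, hz⟩

/-- Spectral (`ℓ₂`) condition number `‖M‖₂ ‖M⁻¹‖₂` of a nonsingular matrix; for a symmetric
positive definite `M` it is the ratio of the largest to the smallest eigenvalue. -/
def condNumber {m : ℕ} (M : Matrix (Fin m) (Fin m) ℝ) : ℝ :=
  ‖Matrix.toEuclideanCLM (𝕜 := ℝ) M‖ * ‖Matrix.toEuclideanCLM (𝕜 := ℝ) M⁻¹‖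

/-- Data of the problem `min ½ xᵀHx - cᵀx` subject to `qᵀx = b`, `l ≤ x ≤ u`.
The bounds are extended reals; `l i < u i` excludes `l i = +∞` and `u i = -∞`. -/
structure SLBQP (n : ℕ) where
  H : Matrix (Fin n) (Fin n) ℝ
  symm : H.IsSymm
  c : EuclideanSpace ℝ (Fin n)
  q : EuclideanSpace ℝ (Fin n)
  b : ℝ
  l : Fin n → EReal
  u : Fin n → EReal
  l_lt_u : ∀ i, l i < u i

namespace SLBQP

variable {n : ℕ} (P : SLBQP n)

/-- The product `H v`. -/
def hess (v : EuclideanSpace ℝ (Fin n)) : EuclideanSpace ℝ (Fin n) :=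
  WithLp.toLp 2 (P.H *ᵥ v.ofLp)

/-- The objective function. -/
def f (x : EuclideanSpace ℝ (Fin n)) : ℝ :=
  (1 / 2) * inner ℝ x (P.hess x) - inner ℝ P.c x

/-- The gradient of `f`. -/
def grad (x : EuclideanSpace ℝ (Fin n)) : EuclideanSpace ℝ (Fin n) :=
  P.hess x - P.c

/-- The feasible set `Ω`. -/
def feasible : Set (EuclideanSpace ℝ (Fin n)) :=
  {x | inner ℝ P.q x = P.b ∧ ∀ i, P.l i ≤ (x i : EReal) ∧ (x i : EReal) ≤ P.u i}

/-- Variables at their lower bound. -/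
def activeLower (x : EuclideanSpace ℝ (Fin n)) : Set (Fin n) := {i | (x i : EReal) = P.l i}

/-- Variables at their upper bound. -/
def activeUpper (x : EuclideanSpace ℝ (Fin n)) : Set (Fin n) := {i | (x i : EReal) = P.u i}

/-- The active set. -/
def active (x : EuclideanSpace ℝ (Fin n)) : Set (Fin n) := P.activeLower x ∪ P.activeUpper x

/-- `x` and `y` have the same active variables, at the same bounds. -/
def SameActive (x y : EuclideanSpace ℝ (Fin n)) : Prop :=
  P.activeLower x = P.activeLower y ∧ P.activeUpper x = P.activeUpper y

/-- The affine closure `Ω(x)` of the face of `Ω` determined by the active set at `x`. -/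
def face (x : EuclideanSpace ℝ (Fin n)) : Set (EuclideanSpace ℝ (Fin n)) :=
  {v | inner ℝ P.q v = P.b ∧ ∀ i ∈ P.active x, v i = x i}

/-- The linear space `Ω₀(x)` parallel to `Ω(x)`. -/
def faceDir (x : EuclideanSpace ℝ (Fin n)) : Set (EuclideanSpace ℝ (Fin n)) :=
  {v | inner ℝ P.q v = 0 ∧ ∀ i ∈ P.active x, v i = 0}

/-- The tangent cone to `Ω` at `x`. -/
def tangentCone (x : EuclideanSpace ℝ (Fin n)) : Set (EuclideanSpace ℝ (Fin n)) :=
  {v | inner ℝ P.q v = 0 ∧ (∀ i ∈ P.activeLower x, 0 ≤ v i) ∧ ∀ i ∈ P.activeUpper x, v i ≤ 0}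

/-- The projected gradient `∇_Ω f(x)`: the point of the tangent cone nearest to `-∇f(x)`. -/
def projGrad (x : EuclideanSpace ℝ (Fin n)) : EuclideanSpace ℝ (Fin n) :=
  metricProj (P.tangentCone x) (-P.grad x)

open Classical in
/-- The multiplier estimate `ρ(x)`; the sums run over the free variables. -/
def rho (x : EuclideanSpace ℝ (Fin n)) : ℝ :=
  if ∀ i, i ∉ P.active x → P.q i = 0 then 0
  else (∑ i with i ∉ P.active x, P.q i * P.grad x i) / ∑ i with i ∉ P.active x, P.q i * P.q i

open Classical in
/-- The free gradient `φ(x)`. -/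
def freeGrad (x : EuclideanSpace ℝ (Fin n)) : EuclideanSpace ℝ (Fin n) :=
  WithLp.toLp 2 fun i => if i ∈ P.active x then 0 else P.grad x i - P.rho x * P.q i

/-- The chopped gradient `β(x)`. -/
def choppedGrad (x : EuclideanSpace ℝ (Fin n)) : EuclideanSpace ℝ (Fin n) :=
  -P.projGrad x - P.freeGrad x

/-- `x` is proportional: `‖β(x)‖_∞ ≤ Γ ‖φ(x)‖₂` (functions `Fin n → ℝ` carry the sup norm). -/
def Proportional (Γ : ℝ) (x : EuclideanSpace ℝ (Fin n)) : Prop :=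
  ‖(P.choppedGrad x).ofLp‖ ≤ Γ * ‖P.freeGrad x‖

/-- The problem is strictly convex: `f` is strictly convex on the hyperplane `qᵀx = b`. -/
def StrictlyConvex : Prop :=
  StrictConvexOn ℝ {x | inner ℝ P.q x = P.b} P.f

/-- `x` is an optimal solution. -/
def IsOptimal (x : EuclideanSpace ℝ (Fin n)) : Prop :=
  x ∈ P.feasible ∧ IsMinOn P.f P.feasible x

/-- `(ρ, lam)` are Lagrange multipliers at `x`, with `lam i = 0` for the inactive `i`. -/
def IsMultiplier (x : EuclideanSpace ℝ (Fin n)) (ρ : ℝ) (lam : Fin n → ℝ) : Prop :=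
  (∀ i, P.grad x i = lam i + ρ * P.q i) ∧ (∀ i, i ∉ P.active x → lam i = 0) ∧
    (∀ i ∈ P.activeLower x, 0 ≤ lam i) ∧ ∀ i ∈ P.activeUpper x, lam i ≤ 0

/-- `x` is nondegenerate: it has Lagrange multipliers that vanish at no active bound. -/
def Nondegenerate (x : EuclideanSpace ℝ (Fin n)) : Prop :=
  ∃ ρ lam, P.IsMultiplier x ρ lam ∧ ∀ i ∈ P.active x, lam i ≠ 0

/-- The columns of `V` are orthonormal and span `{q}^⊥` (so `m = n - 1` if `q ≠ 0`). -/
def IsNullBasis {m : ℕ} (V : Matrix (Fin n) (Fin m) ℝ) : Prop :=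
  Vᵀ * V = 1 ∧ ∀ v : Fin n → ℝ, P.q.ofLp ⬝ᵥ v = 0 ↔ ∃ y, V *ᵥ y = v

/-- The matrix `H_q = Vᵀ H V`. -/
def reducedHessian {m : ℕ} (V : Matrix (Fin n) (Fin m) ℝ) : Matrix (Fin m) (Fin m) ℝ :=
  Vᵀ * P.H * V

end SLBQP

/-- Parameters of the P2GP method. -/
structure P2GPParams where
  tol : ℝ
  η : ℝ
  Γ : ℝ
  γ₁ : ℝ
  γ₂ : ℝ
  γ₃ : ℝ
  μ₁ : ℝ
  μ₂ : ℝ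
  tol_nonneg : 0 ≤ tol
  η_mem : η ∈ Set.Ioo (0 : ℝ) 1
  Γ_pos : 0 < Γ
  γ₁_pos : 0 < γ₁
  γ₂_pos : 0 < γ₂
  γ₃_pos : 0 < γ₃
  μ₁_mem : μ₁ ∈ Set.Ioo (0 : ℝ) 1
  μ₂_mem : μ₂ ∈ Set.Ioo (0 : ℝ) 1

/-- What the method is about to do at the current iterate: a gradient projection step of the
identification phase that began at iteration `m`, a step of the minimization phase, or nothing,
because it has stopped (with `conv` or with `unbnd` true). -/
inductive P2GPPhase where
  | identification (m : ℕ)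
  | minimization
  | converged
  | unbounded

/-- The set `K_GP` of gradient projection iterations of a run with the given phases. -/
def gpIterations (phase : ℕ → P2GPPhase) : Set ℕ := {k | ∃ m, phase k = .identification m}

/-- The run stops at some iteration. -/
def Stops (phase : ℕ → P2GPPhase) : Prop := ∃ k, phase k = .converged ∨ phase k = .unbounded

namespace SLBQP

variable {n : ℕ} (P : SLBQP n)

/-- The stopping test `conv`. -/
def Conv (p : P2GPParams) (x : EuclideanSpace ℝ (Fin n)) : Prop :=
  ‖P.freeGrad x + P.choppedGrad x‖ ≤ p.tol

/-- `x(α) = P_Ω(x - α ∇f(x))`. -/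
def gpArc (x : EuclideanSpace ℝ (Fin n)) (α : ℝ) : EuclideanSpace ℝ (Fin n) :=
  metricProj P.feasible (x - α • P.grad x)

/-- `y` is obtained from `x` by a gradient projection step whose steplength satisfies the
sufficient decrease conditions. -/
def GPStep (p : P2GPParams) (x y : EuclideanSpace ℝ (Fin n)) : Prop :=
  ∃ α : ℝ, y = P.gpArc x α ∧
    P.f y ≤ P.f x + p.μ₁ * inner ℝ (P.grad x) (y - x) ∧
    α ≤ p.γ₁ ∧
    (p.γ₂ ≤ α ∨ ∃ αbar : ℝ, 0 < p.γ₃ * αbar ∧ p.γ₃ * αbar ≤ α ∧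
      P.f x + p.μ₂ * inner ℝ (P.grad x) (P.gpArc x αbar - x) < P.f (P.gpArc x αbar))

/-- The steplengths that are feasible from `x` along `v`. -/
def feasibleSteps (x v : EuclideanSpace ℝ (Fin n)) : Set ℝ := {α | 0 < α ∧ x + α • v ∈ P.feasible}

/-- The step of the minimization phase from `x` to `y` along a direction `v` of positive
curvature: the full step if it is feasible, and a projected step onto `Ω ∩ Ω(x)` otherwise. -/
def MinStep (x v y : EuclideanSpace ℝ (Fin n)) : Prop :=
  P.f y < P.f x ∧
    (x + v ∈ P.feasible → y = x + v) ∧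
    (x + v ∉ P.feasible →
      ∃ α : ℝ, 0 < α ∧ y = metricProj (P.feasible ∩ P.face x) (x + α • v))

open Classical in
/-- One iteration of P2GP, from iterate `k` to iterate `k + 1`; `d k` is the (approximate)
solution of the reduced problem at `x k` that is computed if iteration `k` belongs to the
minimization phase. A zero direction gives no information on boundedness: the iterate is then
repeated and the minimization phase is left. Once the method has stopped, the iterate is repeated. -/
def P2GPIter (p : P2GPParams) (x d : ℕ → EuclideanSpace ℝ (Fin n)) (phase : ℕ → P2GPPhase)
    (k : ℕ) : Prop :=
  match phase k with
  | .converged => x (k + 1) = x k ∧ phase (k + 1) = .converged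
  | .unbounded => x (k + 1) = x k ∧ phase (k + 1) = .unbounded
  | .identification m =>
      if inner ℝ (P.projGrad (x k)) (P.hess (P.projGrad (x k))) ≤ 0 ∧
          ¬ BddAbove (P.feasibleSteps (x k) (P.projGrad (x k))) then
        x (k + 1) = x k ∧ phase (k + 1) = .unbounded
      else
        P.GPStep p (x k) (x (k + 1)) ∧
        phase (k + 1) =
          if P.Conv p (x (k + 1)) then .converged
          else if ¬ P.SameActive (x (k + 1)) (x k) ∧
              ∀ j, m ≤ j → j < k →
                p.η * (P.f (x j) - P.f (x (j + 1))) < P.f (x k) - P.f (x (k + 1)) then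
            .identification m
          else .minimization
  | .minimization =>
      d k ∈ P.faceDir (x k) ∧
      if inner ℝ (d k) (P.hess (d k)) ≤ 0 then
        if d k ≠ 0 ∧ ¬ BddAbove (P.feasibleSteps (x k) (d k)) then
          x (k + 1) = x k ∧ phase (k + 1) = .unbounded
        else
          (∃ α : ℝ, (d k ≠ 0 → IsGreatest (P.feasibleSteps (x k) (d k)) α) ∧
            x (k + 1) = x k + α • d k) ∧
          phase (k + 1) =
            if P.Conv p (x (k + 1)) then .converged else .identification (k + 1)
      else
        P.MinStep (x k) (d k) (x (k + 1)) ∧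
        phase (k + 1) =
          if P.Conv p (x (k + 1)) then .converged
          else if P.Proportional p.Γ (x (k + 1)) then .minimization
          else .identification (k + 1)

open Classical in
/-- `x` is a sequence generated by P2GP, with directions `d` and phases `phase`. -/
structure IsP2GPRun (p : P2GPParams) (x d : ℕ → EuclideanSpace ℝ (Fin n))
    (phase : ℕ → P2GPPhase) : Prop where
  start_mem : x 0 ∈ P.feasible
  start_phase : phase 0 = if P.Conv p (x 0) then .converged else .identification 0
  iter : ∀ k, P.P2GPIter p x d phase k

/-- The algorithm used in the minimization phase is exact for strictly convex quadratic
programming: whenever the reduced problem `min f(xᵏ + v)`, `v ∈ Ω₀(xᵏ)`, is strictly convex,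
`dᵏ` is its solution. -/
def ExactMinimization (x d : ℕ → EuclideanSpace ℝ (Fin n)) (phase : ℕ → P2GPPhase) : Prop :=
  ∀ k, phase k = .minimization →
    StrictConvexOn ℝ (P.faceDir (x k)) (fun v => P.f (x k + v)) →
      d k ∈ P.faceDir (x k) ∧ IsMinOn (fun v => P.f (x k + v)) (P.faceDir (x k)) (d k)

end SLBQP

end

open Filter Topology

/-! On the hyperplane `qᵀx = b` the curvature of `f` is bounded below by some `σ > 0`, so small
optimality gaps mean points close to `x*`. Accepted gradient projection steplengths are bounded away
from zero, hence each GP step leaves a gap of at most a constant times the decrease it achieves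
(`exists_gap_le_decrease`). No step increases `f`, and GP steps occur infinitely often unless the
run stops, so in an infinite run the gap tends to zero and `xᵏ → x*` (`IsP2GPRun.tendsto`).

Finite termination comes from the faces. If `y = P_Ω(x - α∇f(x))`, then `α∇f(x)` and `x - y` agree
along the directions of the face of `y`. As `x - y → 0` and `α ≥ a > 0`, and there are only finitely
many active sets, late GP steps land on faces orthogonal to `∇f(x*)`
(`IsP2GPRun.eventually_inner_grad_eq_zero`). Bounds active near `x*` are active at `x*`, so `x*`
lies in the affine hull of such a face and minimizes `f` there. The first exact minimization step
after a late GP step therefore hits `x*`. An identification phase cannot last forever, since its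
decreases would stay above a positive constant (`IsP2GPRun.exists_minimization`). Positive curvature
rules out the unbounded exit, so stopping means having reached `x*`. -/

/-! ### Projection inequality and a convergence criterion. -/

theorem inner_metricProj_le_zero {E : Type*} [NormedAddCommGroup E] [InnerProductSpace ℝ E]
    [CompleteSpace E] {S : Set E} (hcl : IsClosed S) (hcv : Convex ℝ S)
    (y : E) {z : E} (hz : z ∈ S) :
    inner ℝ (y - metricProj S y) (z - metricProj S y) ≤ 0 := by
  obtain ⟨hmem, hmin⟩ := metricProj_spec ⟨z, hz⟩ hcl hcv y
  have : Nonempty S := ⟨⟨z, hz⟩⟩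
  refine (norm_eq_iInf_iff_real_inner_le_zero hcv hmem).1 (le_antisymm ?_ ?_) z hz
  · refine le_ciInf fun w => ?_
    rw [norm_sub_rev y, norm_sub_rev y]
    exact hmin w w.2
  · exact ciInf_le (f := fun w : S => ‖y - w‖)
      ⟨0, by rintro _ ⟨w, rfl⟩; exact norm_nonneg _⟩ ⟨_, hmem⟩

/-- A nonnegative antitone sequence that is infinitely often bounded by a multiple of its last
decrease converges to zero. -/
theorem tendsto_zero_of_frequently_le_decrease {e : ℕ → ℝ} (hanti : Antitone e)
    (hnonneg : ∀ k, 0 ≤ e k) {C : ℝ}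
    (hfreq : ∃ᶠ k in atTop, e (k + 1) ≤ C * (e k - e (k + 1))) :
    Tendsto e atTop (𝓝 0) := by
  have hlim := tendsto_atTop_ciInf hanti ⟨0, by rintro _ ⟨k, rfl⟩; exact hnonneg k⟩
  set L := ⨅ k, e k
  have hlim' : Tendsto (fun k => e (k + 1)) atTop (𝓝 L) := (tendsto_add_atTop_iff_nat 1).2 hlim
  have hdiff : Tendsto (fun k => C * (e k - e (k + 1))) atTop (𝓝 0) := by
    simpa using (hlim.sub hlim').const_mul C
  have h0 : 0 ≤ L := ge_of_tendsto' hlim hnonneg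
  -- The decreases vanish in the limit, so the frequent inequality passes to `L ≤ C * 0`.
  have h1 : L ≤ 0 := le_of_tendsto_of_frequently (f := fun k => e (k + 1) - C * (e k - e (k + 1)))
    (by simpa using hlim'.sub hdiff) (hfreq.mono fun k hk => by linarith)
  rwa [le_antisymm h1 h0] at hlim

/-! ### The quadratic objective and its curvature on the hyperplane. -/

namespace SLBQP

variable {n : ℕ} (P : SLBQP n)

theorem hess_eq (v : EuclideanSpace ℝ (Fin n)) :
    P.hess v = Matrix.toEuclideanCLM (𝕜 := ℝ) P.H v := rfl

theorem hess_add (v w : EuclideanSpace ℝ (Fin n)) : P.hess (v + w) = P.hess v + P.hess w := by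
  simp only [hess_eq, map_add]

theorem hess_smul (t : ℝ) (v : EuclideanSpace ℝ (Fin n)) : P.hess (t • v) = t • P.hess v := by
  simp only [hess_eq, map_smul]

theorem continuous_hess : Continuous P.hess :=
  (Matrix.toEuclideanCLM (𝕜 := ℝ) P.H).continuous

theorem inner_hess_comm (v w : EuclideanSpace ℝ (Fin n)) :
    inner ℝ v (P.hess w) = inner ℝ w (P.hess v) := by
  simp only [hess, EuclideanSpace.inner_eq_star_dotProduct, star_trivial]
  rw [dotProduct_comm, Matrix.dotProduct_mulVec, ← Matrix.mulVec_transpose, P.symm.eq,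
    dotProduct_comm, dotProduct_comm]

theorem f_add (x v : EuclideanSpace ℝ (Fin n)) :
    P.f (x + v) = P.f x + inner ℝ (P.grad x) v + 1 / 2 * inner ℝ v (P.hess v) := by
  simp only [f, grad, hess_add, inner_add_left, inner_add_right, inner_sub_left]
  rw [P.inner_hess_comm v x, real_inner_comm v (P.hess x), P.inner_hess_comm v x]
  ring

theorem f_eq (x y : EuclideanSpace ℝ (Fin n)) :
    P.f y = P.f x + inner ℝ (P.grad x) (y - x) + 1 / 2 * inner ℝ (y - x) (P.hess (y - x)) := by
  rw [← P.f_add, add_sub_cancel]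

theorem continuous_grad : Continuous P.grad := P.continuous_hess.sub continuous_const

theorem grad_sub_grad (x y : EuclideanSpace ℝ (Fin n)) :
    P.grad y - P.grad x = P.hess (y - x) := by
  simp only [grad, hess_eq, map_sub]; abel

theorem exists_norm_hess_le : ∃ M > 0, ∀ v, ‖P.hess v‖ ≤ M * ‖v‖ := by
  refine ⟨‖Matrix.toEuclideanCLM (𝕜 := ℝ) P.H‖ + 1, by positivity, fun v => ?_⟩
  have := (Matrix.toEuclideanCLM (𝕜 := ℝ) P.H).le_opNorm v
  rw [hess_eq]
  nlinarith [norm_nonneg v]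

variable {P} {x y v xs : EuclideanSpace ℝ (Fin n)}

/-- Strict convexity at the midpoint of `x` and `x + v` cancels the first-order terms and leaves
`1/8 vᵀHv < 1/4 vᵀHv`. The feasible `x` only supplies a point of the hyperplane. -/
theorem StrictlyConvex.inner_hess_pos (h : P.StrictlyConvex) (hx : x ∈ P.feasible)
    (hv : inner ℝ P.q v = 0) (hv0 : v ≠ 0) : 0 < inner ℝ v (P.hess v) := by
  have hxv : x + v ∈ {x | inner ℝ P.q x = P.b} := by
    simp only [Set.mem_ofPred_eq, inner_add_right, hv, hx.1, add_zero]
  have := h.2 hx.1 hxv (by simpa using hv0) (by norm_num : (0 : ℝ) < 1 / 2)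
    (by norm_num : (0 : ℝ) < 1 / 2) (by norm_num)
  rw [show (1 / 2 : ℝ) • x + (1 / 2 : ℝ) • (x + v) = x + (1 / 2 : ℝ) • v by module,
    f_add, f_add, hess_smul, inner_smul_right, inner_smul_right, real_inner_smul_left] at this
  simp only [smul_eq_mul] at this
  linarith

theorem StrictlyConvex.exists_le_inner_hess (h : P.StrictlyConvex) (hx : x ∈ P.feasible) :
    ∃ σ > 0, ∀ v, inner ℝ P.q v = 0 → σ * ‖v‖ ^ 2 ≤ inner ℝ v (P.hess v) := by
  have hcont : Continuous fun v => inner ℝ v (P.hess v) := continuous_id.inner P.continuous_hess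
  have hcomp : IsCompact (Metric.sphere (0 : EuclideanSpace ℝ (Fin n)) 1 ∩ {v | inner ℝ P.q v = 0}) :=
    (isCompact_sphere 0 1).inter_right
      (isClosed_eq (continuous_const.inner continuous_id) continuous_const)
  rcases (Metric.sphere (0 : EuclideanSpace ℝ (Fin n)) 1 ∩
    {v | inner ℝ P.q v = 0}).eq_empty_or_nonempty with hemp | hne
  -- No unit vector is orthogonal to `q`, so `v = 0` is the only case and any constant serves.
  · refine ⟨1, one_pos, fun v hv => ?_⟩
    rcases eq_or_ne v 0 with rfl | hv0
    · simp
    · refine (Set.eq_empty_iff_forall_notMem.1 hemp (‖v‖⁻¹ • v) ⟨?_, ?_⟩).elim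
      · simp [norm_smul, hv0]
      · simp [inner_smul_right, hv]
  · obtain ⟨w, ⟨hw1, hw2⟩, hmin⟩ := hcomp.exists_isMinOn hne hcont.continuousOn
    refine ⟨_, h.inner_hess_pos hx hw2 (by rintro rfl; simp at hw1), fun v hv => ?_⟩
    rcases eq_or_ne v 0 with rfl | hv0
    · simp
    · have hn : ‖v‖ ≠ 0 := norm_ne_zero_iff.2 hv0
      have := isMinOn_iff.1 hmin (‖v‖⁻¹ • v)
        ⟨by simp [norm_smul, hv0], by simp [inner_smul_right, hv]⟩
      rw [hess_smul, inner_smul_right, real_inner_smul_left] at this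
      calc _ ≤ ‖v‖⁻¹ * (‖v‖⁻¹ * inner ℝ v (P.hess v)) * ‖v‖ ^ 2 := by gcongr
        _ = _ := by field_simp

theorem inner_q_sub (hx : inner ℝ P.q x = P.b) (hy : inner ℝ P.q y = P.b) :
    inner ℝ P.q (y - x) = 0 := by rw [inner_sub_right, hx, hy, sub_self]

/-! ### Geometry of the feasible set, its faces and tangent cones. -/

variable (P) in
theorem isClosed_feasible : IsClosed P.feasible := by
  have hc : ∀ i, Continuous fun x : EuclideanSpace ℝ (Fin n) => (x i : EReal) := fun i =>
    continuous_coe_real_ereal.comp (by fun_prop)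
  simp only [feasible, Set.ofPred_and, Set.ofPred_forall]
  exact (isClosed_eq (by fun_prop) continuous_const).inter <| isClosed_iInter fun i =>
    (isClosed_le continuous_const (hc i)).inter (isClosed_le (hc i) continuous_const)

variable (P) in
theorem convex_feasible : Convex ℝ P.feasible := by
  intro x hx y hy s t hs ht hst
  refine ⟨?_, fun i => ?_⟩
  · rw [inner_add_right, inner_smul_right, inner_smul_right, hx.1, hy.1, ← add_mul, hst, one_mul]
  · have hord : ((fun r : ℝ => (r : EReal)) ⁻¹' Set.Icc (P.l i) (P.u i)).OrdConnected :=
      Set.ordConnected_Icc.preimage_mono EReal.coe_strictMono.monotone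
    simpa using hord.convex (hx.2 i) (hy.2 i) hs ht hst

variable (P) in
theorem isClosed_face (x : EuclideanSpace ℝ (Fin n)) : IsClosed (P.face x) := by
  simp only [face, Set.ofPred_and, Set.ofPred_forall]
  exact (isClosed_eq (by fun_prop) continuous_const).inter <| isClosed_iInter fun i =>
    isClosed_iInter fun _ => isClosed_eq (by fun_prop) continuous_const

variable (P) in
theorem convex_face (x : EuclideanSpace ℝ (Fin n)) : Convex ℝ (P.face x) := by
  intro v hv w hw s t hs ht hst
  refine ⟨?_, fun i hi => ?_⟩
  · rw [inner_add_right, inner_smul_right, inner_smul_right, hv.1, hw.1, ← add_mul, hst, one_mul]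
  · simp [hv.2 i hi, hw.2 i hi, ← add_mul, hst]

variable (P) in
theorem isClosed_tangentCone (x : EuclideanSpace ℝ (Fin n)) : IsClosed (P.tangentCone x) := by
  simp only [tangentCone, Set.ofPred_and, Set.ofPred_forall]
  exact (isClosed_eq (by fun_prop) continuous_const).inter <|
    (isClosed_iInter fun i => isClosed_iInter fun _ => isClosed_le continuous_const (by fun_prop)).inter
    (isClosed_iInter fun i => isClosed_iInter fun _ => isClosed_le (by fun_prop) continuous_const)

variable (P) in
theorem convex_tangentCone (x : EuclideanSpace ℝ (Fin n)) : Convex ℝ (P.tangentCone x) := by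
  intro v hv w hw s t hs ht hst
  refine ⟨?_, fun i hi => ?_, fun i hi => ?_⟩
  · rw [inner_add_right, inner_smul_right, inner_smul_right, hv.1, hw.1]; simp
  · have := hv.2.1 i hi
    have := hw.2.1 i hi
    simp only [PiLp.add_apply, PiLp.smul_apply, smul_eq_mul]
    positivity
  · have := mul_nonpos_of_nonneg_of_nonpos hs (hv.2.2 i hi)
    have := mul_nonpos_of_nonneg_of_nonpos ht (hw.2.2 i hi)
    simp only [PiLp.add_apply, PiLp.smul_apply, smul_eq_mul]
    linarith

variable (P) in
theorem zero_mem_tangentCone (x : EuclideanSpace ℝ (Fin n)) : 0 ∈ P.tangentCone x := by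
  simp [tangentCone]

theorem sub_mem_tangentCone (hx : x ∈ P.feasible) (hy : y ∈ P.feasible) :
    y - x ∈ P.tangentCone x := by
  refine ⟨inner_q_sub hx.1 hy.1, fun i hi => ?_, fun i hi => ?_⟩
  · have := (hy.2 i).1
    rw [← show (x i : EReal) = P.l i from hi] at this
    simpa using this
  · have := (hy.2 i).2
    rw [← show (x i : EReal) = P.u i from hi] at this
    simpa using this

theorem projGrad_mem : P.projGrad x ∈ P.tangentCone x :=
  (metricProj_spec ⟨0, P.zero_mem_tangentCone x⟩ (P.isClosed_tangentCone x)
    (P.convex_tangentCone x) _).1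

theorem faceDir_subset_tangentCone : P.faceDir x ⊆ P.tangentCone x := fun _ hv =>
  ⟨hv.1, fun i hi => (hv.2 i (Or.inl hi)).ge, fun i hi => (hv.2 i (Or.inr hi)).le⟩

theorem neg_mem_faceDir (hv : v ∈ P.faceDir x) : -v ∈ P.faceDir x :=
  ⟨by rw [inner_neg_right, hv.1, neg_zero], fun i hi => by simp [hv.2 i hi]⟩

theorem add_mem_faceDir {w : EuclideanSpace ℝ (Fin n)} (hv : v ∈ P.faceDir x)
    (hw : w ∈ P.faceDir x) : v + w ∈ P.faceDir x :=
  ⟨by rw [inner_add_right, hv.1, hw.1, add_zero], fun i hi => by simp [hv.2 i hi, hw.2 i hi]⟩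

variable (P) in
theorem convex_faceDir (x : EuclideanSpace ℝ (Fin n)) : Convex ℝ (P.faceDir x) := by
  intro v hv w hw s t hs ht hst
  refine ⟨?_, fun i hi => ?_⟩
  · rw [inner_add_right, inner_smul_right, inner_smul_right, hv.1, hw.1]; simp
  · simp [hv.2 i hi, hw.2 i hi]

/-- Tangent directions are feasible directions. -/
theorem eventually_add_smul_mem_feasible (hx : x ∈ P.feasible) (hv : v ∈ P.tangentCone x) :
    ∀ᶠ t : ℝ in 𝓝[>] 0, x + t • v ∈ P.feasible := by
  have hc : ∀ i, Tendsto (fun t : ℝ => ((x i + t * v i : ℝ) : EReal)) (𝓝[>] 0) (𝓝 (x i)) := by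
    intro i
    have : Continuous fun t : ℝ => ((x i + t * v i : ℝ) : EReal) :=
      continuous_coe_real_ereal.comp (by fun_prop)
    simpa using (this.tendsto 0).mono_left nhdsWithin_le_nhds
  have hl : ∀ i, ∀ᶠ t : ℝ in 𝓝[>] 0, P.l i ≤ ((x i + t * v i : ℝ) : EReal) := fun i => by
    rcases (hx.2 i).1.lt_or_eq with hlt | heq
    · exact ((hc i).eventually (lt_mem_nhds hlt)).mono fun _ h => h.le
    · filter_upwards [self_mem_nhdsWithin] with t ht
      have := hv.2.1 i heq.symm
      rw [heq, EReal.coe_le_coe_iff]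
      nlinarith [Set.mem_Ioi.1 ht]
  have hu : ∀ i, ∀ᶠ t : ℝ in 𝓝[>] 0, ((x i + t * v i : ℝ) : EReal) ≤ P.u i := fun i => by
    rcases (hx.2 i).2.lt_or_eq with hlt | heq
    · exact ((hc i).eventually (gt_mem_nhds hlt)).mono fun _ h => h.le
    · filter_upwards [self_mem_nhdsWithin] with t ht
      have := hv.2.2 i heq
      rw [← heq, EReal.coe_le_coe_iff]
      nlinarith [Set.mem_Ioi.1 ht]
  filter_upwards [eventually_all.2 hl, eventually_all.2 hu] with t h1 h2
  refine ⟨by rw [inner_add_right, inner_smul_right, hv.1, hx.1]; simp, fun i => ?_⟩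
  simpa using ⟨h1 i, h2 i⟩

theorem exists_add_smul_mem_feasible (hx : x ∈ P.feasible) (hv : v ∈ P.tangentCone x) :
    ∃ t : ℝ, 0 < t ∧ x + t • v ∈ P.feasible :=
  ((eventually_mem_nhdsWithin (a := (0 : ℝ)) (s := Set.Ioi 0)).and
    (eventually_add_smul_mem_feasible hx hv)).exists

/-! ### Optimality conditions and the stopping test. -/

theorem IsOptimal.inner_grad_nonneg (h : P.IsOptimal xs) (hv : v ∈ P.tangentCone xs) :
    0 ≤ inner ℝ (P.grad xs) v := by
  have hlim : Tendsto (fun t : ℝ => inner ℝ (P.grad xs) v + t * (1 / 2 * inner ℝ v (P.hess v)))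
      (𝓝[>] 0) (𝓝 (inner ℝ (P.grad xs) v)) := by
    have : Continuous fun t : ℝ => inner ℝ (P.grad xs) v + t * (1 / 2 * inner ℝ v (P.hess v)) := by
      fun_prop
    simpa using (this.tendsto 0).mono_left nhdsWithin_le_nhds
  refine ge_of_tendsto hlim ?_
  filter_upwards [eventually_add_smul_mem_feasible h.1 hv, self_mem_nhdsWithin] with t ht ht0
  have := isMinOn_iff.1 h.2 _ ht
  rw [f_add, hess_smul, inner_smul_right, inner_smul_right, real_inner_smul_left] at this
  have ht0 : 0 < t := ht0
  refine nonneg_of_mul_nonneg_right (a := t) ?_ ht0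
  linarith

theorem IsOptimal.projGrad_eq_zero (h : P.IsOptimal xs) : P.projGrad xs = 0 := by
  have h1 := inner_metricProj_le_zero (P.isClosed_tangentCone xs) (P.convex_tangentCone xs)
    (-P.grad xs) (P.zero_mem_tangentCone xs)
  have h2 := h.inner_grad_nonneg (P.projGrad_mem (x := xs))
  change inner ℝ (-P.grad xs - P.projGrad xs) (0 - P.projGrad xs) ≤ 0 at h1
  rw [zero_sub, inner_neg_right, inner_sub_left, inner_neg_left, real_inner_self_eq_norm_sq] at h1
  have : ‖P.projGrad xs‖ ^ 2 ≤ 0 := by linarith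
  exact norm_eq_zero.1 (pow_eq_zero_iff two_ne_zero |>.1 (le_antisymm this (sq_nonneg _)))

/-- Quadratic growth: this is what turns convergence of values into convergence of iterates. -/
theorem IsOptimal.le_f_sub {σ : ℝ} (h : P.IsOptimal xs)
    (hσ : ∀ v, inner ℝ P.q v = 0 → σ * ‖v‖ ^ 2 ≤ inner ℝ v (P.hess v)) (hy : y ∈ P.feasible) :
    σ / 2 * ‖y - xs‖ ^ 2 ≤ P.f y - P.f xs := by
  have h1 := h.inner_grad_nonneg (sub_mem_tangentCone h.1 hy)
  have h2 := hσ _ (inner_q_sub h.1.1 hy.1)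
  rw [P.f_eq xs y]
  linarith

theorem IsOptimal.eq_of_stationary (hconv : P.StrictlyConvex) (h : P.IsOptimal xs)
    (hx : x ∈ P.feasible) (hs : 0 ≤ inner ℝ (P.grad x) (xs - x)) : x = xs := by
  by_contra hne
  have h1 := hconv.inner_hess_pos hx (inner_q_sub hx.1 h.1.1) (sub_ne_zero.2 (Ne.symm hne))
  have h2 := isMinOn_iff.1 h.2 x hx
  rw [P.f_eq x xs] at h2
  linarith

theorem IsOptimal.projGrad_eq_zero_iff (hconv : P.StrictlyConvex) (h : P.IsOptimal xs)
    (hx : x ∈ P.feasible) : P.projGrad x = 0 ↔ x = xs := by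
  refine ⟨fun h0 => h.eq_of_stationary hconv hx ?_, fun hx => hx ▸ h.projGrad_eq_zero⟩
  have h1 := inner_metricProj_le_zero (P.isClosed_tangentCone x) (P.convex_tangentCone x)
    (-P.grad x) (sub_mem_tangentCone hx h.1)
  change inner ℝ (-P.grad x - P.projGrad x) (xs - x - P.projGrad x) ≤ 0 at h1
  rw [h0, sub_zero, sub_zero, inner_neg_left] at h1
  linarith

/-- By the definition of `β`, the tested vector `φ + β` is `-∇_Ω f`, which vanishes only at the
solution. -/
theorem IsOptimal.conv_iff {p : P2GPParams} (htol : p.tol = 0) (hconv : P.StrictlyConvex)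
    (h : P.IsOptimal xs) (hx : x ∈ P.feasible) : P.Conv p x ↔ x = xs := by
  rw [← h.projGrad_eq_zero_iff hconv hx, Conv, htol, choppedGrad, norm_le_zero_iff,
    add_sub_cancel, neg_eq_zero]

/-! ### Gradient projection steps. -/

theorem gpArc_mem (hx : x ∈ P.feasible) (α : ℝ) : P.gpArc x α ∈ P.feasible :=
  (metricProj_spec ⟨x, hx⟩ P.isClosed_feasible P.convex_feasible _).1

theorem inner_gpArc_le (hy : y ∈ P.feasible) (x : EuclideanSpace ℝ (Fin n)) (α : ℝ) :
    inner ℝ (x - α • P.grad x - P.gpArc x α) (y - P.gpArc x α) ≤ 0 :=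
  inner_metricProj_le_zero P.isClosed_feasible P.convex_feasible _ hy

theorem norm_gpArc_sub_sq_le (hx : x ∈ P.feasible) (α : ℝ) :
    ‖P.gpArc x α - x‖ ^ 2 ≤ α * -inner ℝ (P.grad x) (P.gpArc x α - x) := by
  have := inner_gpArc_le hx x α
  rw [show x - α • P.grad x - P.gpArc x α = -((P.gpArc x α - x) + α • P.grad x) by abel,
    ← neg_sub (P.gpArc x α) x, inner_neg_neg, inner_add_left, real_inner_smul_left,
    real_inner_self_eq_norm_sq] at this
  linarith

/-- Along the directions of the face that contains `P_Ω(x - α ∇f(x))`, the gradient at `x` is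
controlled by the length of the step. -/
theorem inner_grad_eq_of_mem_faceDir_gpArc {α : ℝ} (hx : x ∈ P.feasible)
    (hv : v ∈ P.faceDir (P.gpArc x α)) :
    α * inner ℝ (P.grad x) v = inner ℝ (x - P.gpArc x α) v := by
  have key : ∀ w ∈ P.faceDir (P.gpArc x α),
      inner ℝ (x - P.gpArc x α) w ≤ α * inner ℝ (P.grad x) w := by
    intro w hw
    obtain ⟨t, ht, hmem⟩ := exists_add_smul_mem_feasible (gpArc_mem hx α)
      (faceDir_subset_tangentCone hw)
    have := inner_gpArc_le hmem x α
    rw [add_sub_cancel_left, inner_smul_right, sub_right_comm, inner_sub_left,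
      real_inner_smul_left] at this
    nlinarith
  -- Face directions form a linear space, so the one-sided bound for `v` and `-v` is an equality.
  have h1 := key v hv
  have h2 := key _ (neg_mem_faceDir hv)
  rw [inner_neg_right, inner_neg_right] at h2
  linarith

/-- The steplengths accepted in the identification phase are bounded away from zero. -/
theorem exists_le_steplength (P : SLBQP n) (p : P2GPParams) :
    ∃ a > 0, ∀ x y, x ∈ P.feasible → P.GPStep p x y → ∃ α, a ≤ α ∧ α ≤ p.γ₁ ∧ y = P.gpArc x α ∧
      P.f y ≤ P.f x + p.μ₁ * inner ℝ (P.grad x) (y - x) := by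
  obtain ⟨M, hM, hMle⟩ := P.exists_norm_hess_le
  have hμ : 0 < 1 - p.μ₂ := sub_pos.2 p.μ₂_mem.2
  have hγ := p.γ₃_pos
  -- With `s` the trial step, failure of the `μ₂` test gives `(1 - μ₂)(-∇fᵀs) < ½ sᵀHs ≤ (M/2)‖s‖²`,
  -- while `‖s‖² ≤ ᾱ(-∇fᵀs)`; together these force `ᾱ ≥ 2(1 - μ₂)/M`.
  refine ⟨min p.γ₂ (p.γ₃ * (2 * (1 - p.μ₂) / M)), lt_min p.γ₂_pos (by positivity), ?_⟩
  rintro x y hx ⟨α, hy, hdec, hle, hα⟩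
  refine ⟨α, ?_, hle, hy, hdec⟩
  rcases hα with hα | ⟨β, hβ, hβα, hlt⟩
  · exact min_le_of_left_le hα
  · refine min_le_of_right_le (le_trans ?_ hβα)
    have hβ : 0 < β := pos_of_mul_pos_right hβ hγ.le
    refine mul_le_mul_of_nonneg_left ?_ hγ.le
    have h1 := norm_gpArc_sub_sq_le hx β
    rw [P.f_eq x (P.gpArc x β)] at hlt
    set s := P.gpArc x β - x
    have h2 : inner ℝ s (P.hess s) ≤ M * ‖s‖ ^ 2 := by
      calc _ ≤ ‖s‖ * ‖P.hess s‖ := real_inner_le_norm _ _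
        _ ≤ ‖s‖ * (M * ‖s‖) := by gcongr; exact hMle s
        _ = _ := by ring
    have h3 : 0 < ‖s‖ ^ 2 := by
      refine pow_pos (norm_pos_iff.2 fun h0 => ?_) 2
      rw [h0] at hlt
      simp at hlt
    have h4 : (1 - p.μ₂) * ‖s‖ ^ 2 ≤ (β * M / 2) * ‖s‖ ^ 2 := by
      have h5 : (1 - p.μ₂) * -inner ℝ (P.grad x) s ≤ M / 2 * ‖s‖ ^ 2 := by linarith
      have h6 := mul_le_mul_of_nonneg_left h1 hμ.le
      have h7 := mul_le_mul_of_nonneg_left h5 hβ.le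
      linarith
    have := le_of_mul_le_mul_right h4 h3
    rw [div_le_iff₀ hM]
    linarith

theorem GPStep.mem_feasible {p : P2GPParams} (h : P.GPStep p x y) (hx : x ∈ P.feasible) :
    y ∈ P.feasible := by
  obtain ⟨α, rfl, -⟩ := h
  exact gpArc_mem hx α

theorem GPStep.norm_sq_le {p : P2GPParams} (h : P.GPStep p x y) (hx : x ∈ P.feasible) :
    p.μ₁ * ‖y - x‖ ^ 2 ≤ p.γ₁ * (P.f x - P.f y) := by
  obtain ⟨a, ha, H⟩ := exists_le_steplength P p
  obtain ⟨α, haα, hα, rfl, hdec⟩ := H x y hx h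
  have h0 := norm_gpArc_sub_sq_le hx α
  have hμ := p.μ₁_mem.1
  have hγ := p.γ₁_pos
  have h1 : 0 ≤ -inner ℝ (P.grad x) (P.gpArc x α - x) :=
    nonneg_of_mul_nonneg_right (a := α) ((sq_nonneg _).trans h0) (ha.trans_le haα)
  have h2 : ‖P.gpArc x α - x‖ ^ 2 ≤ p.γ₁ * -inner ℝ (P.grad x) (P.gpArc x α - x) :=
    h0.trans (by gcongr)
  calc _ ≤ p.μ₁ * (p.γ₁ * -inner ℝ (P.grad x) (P.gpArc x α - x)) := by gcongr
    _ = p.γ₁ * (p.μ₁ * -inner ℝ (P.grad x) (P.gpArc x α - x)) := by ring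
    _ ≤ _ := by gcongr; linarith

theorem GPStep.f_le {p : P2GPParams} (h : P.GPStep p x y) (hx : x ∈ P.feasible) :
    P.f y ≤ P.f x := by
  have h1 := h.norm_sq_le hx
  have : 0 ≤ p.μ₁ * ‖y - x‖ ^ 2 := mul_nonneg p.μ₁_mem.1.le (sq_nonneg _)
  have := nonneg_of_mul_nonneg_right (this.trans h1) p.γ₁_pos
  linarith

/-- A null step with `α > 0` would make `x` a fixed point of the projected gradient map, hence
stationary. -/
theorem GPStep.f_lt {p : P2GPParams} (hconv : P.StrictlyConvex) (hopt : P.IsOptimal xs)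
    (h : P.GPStep p x y) (hx : x ∈ P.feasible) (hne : x ≠ xs) : P.f y < P.f x := by
  have hyx : y ≠ x := by
    rintro rfl
    obtain ⟨a, ha, H⟩ := exists_le_steplength P p
    obtain ⟨α, haα, -, hy, -⟩ := H y y hx h
    refine hne (hopt.eq_of_stationary hconv hx ?_)
    have := inner_gpArc_le hopt.1 y α
    rw [← hy, sub_right_comm, sub_self, zero_sub, inner_neg_left, real_inner_smul_left] at this
    exact nonneg_of_mul_nonneg_right (a := α) (by linarith) (ha.trans_le haα)
  have h1 := h.norm_sq_le hx
  have : 0 < p.μ₁ * ‖y - x‖ ^ 2 :=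
    mul_pos p.μ₁_mem.1 (pow_pos (norm_pos_iff.2 (sub_ne_zero.2 hyx)) 2)
  have := pos_of_mul_pos_right (this.trans_le h1) p.γ₁_pos.le
  linarith

/-- A gradient projection step reduces the optimality gap by a constant factor. -/
theorem exists_gap_le_decrease (hconv : P.StrictlyConvex) (hopt : P.IsOptimal xs)
    (p : P2GPParams) : ∃ C, ∀ x y, x ∈ P.feasible → P.GPStep p x y →
      P.f y - P.f xs ≤ C * (P.f x - P.f y) := by
  obtain ⟨a, ha, H⟩ := exists_le_steplength P p
  obtain ⟨M, hM, hMle⟩ := P.exists_norm_hess_le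
  obtain ⟨σ, hσ, hσle⟩ := hconv.exists_le_inner_hess hopt.1
  -- With `D = 1/a + M`, the gap at `y` is at most `D‖y - x‖‖y - x*‖`. Quadratic growth then gives
  -- `‖y - x*‖ ≤ (2D/σ)‖y - x‖`, and `‖y - x‖²` is at most `γ₁/μ₁` times the decrease.
  refine ⟨2 * (1 / a + M) ^ 2 / σ * (p.γ₁ / p.μ₁), fun x y hx h => ?_⟩
  have hsq := h.norm_sq_le hx
  have hy := h.mem_feasible hx
  obtain ⟨α, haα, -, hyα, -⟩ := H x y hx h
  have hα : 0 < α := ha.trans_le haα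
  have hgap := hopt.le_f_sub hσle hy
  have hvi := inner_gpArc_le hopt.1 x α
  rw [← hyα, show x - α • P.grad x - y = -((y - x) + α • P.grad x) by abel, ← neg_sub y xs,
    inner_neg_neg, inner_add_left, real_inner_smul_left] at hvi
  have h1 : inner ℝ (P.grad x) (y - xs) ≤ 1 / a * (‖y - x‖ * ‖y - xs‖) := by
    have h2 : α * inner ℝ (P.grad x) (y - xs) ≤ ‖y - x‖ * ‖y - xs‖ := by
      have := neg_le_of_abs_le (abs_real_inner_le_norm (y - x) (y - xs))
      linarith
    calc _ ≤ 1 / α * (‖y - x‖ * ‖y - xs‖) := by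
          rw [one_div, ← div_eq_inv_mul, le_div_iff₀ hα]; linarith
      _ ≤ _ := by gcongr
  have h2 : inner ℝ (P.hess (y - x)) (y - xs) ≤ M * (‖y - x‖ * ‖y - xs‖) := by
    calc _ ≤ ‖P.hess (y - x)‖ * ‖y - xs‖ := real_inner_le_norm _ _
      _ ≤ M * ‖y - x‖ * ‖y - xs‖ := by gcongr; exact hMle _
      _ = _ := by ring
  -- Convexity bounds the gap by `∇f(y)ᵀ(y - x*)`, and `∇f(y) = ∇f(x) + H(y - x)` splits this into
  -- `h1` and `h2`.
  have h3 : P.f y - P.f xs ≤ (1 / a + M) * ‖y - x‖ * ‖y - xs‖ := by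
    have h4 := P.f_eq y xs
    have h5 := hσle _ (inner_q_sub hy.1 hopt.1.1)
    have h6 : 0 ≤ σ * ‖xs - y‖ ^ 2 := by positivity
    rw [← neg_sub y xs, inner_neg_right, neg_sub] at h4
    rw [← P.grad_sub_grad, inner_sub_left] at h2
    rw [← neg_sub y xs] at h5 h6
    rw [← neg_sub y xs] at h4
    linarith
  set D := 1 / a + M
  have hD : 0 < D := by positivity
  have h4 : ‖y - xs‖ ≤ 2 * D / σ * ‖y - x‖ := by
    rcases (norm_nonneg (y - xs)).eq_or_lt with h0 | h0
    · rw [← h0]; positivity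
    · have : σ / 2 * ‖y - xs‖ ≤ D * ‖y - x‖ :=
        le_of_mul_le_mul_right (by linarith) h0
      rw [div_mul_eq_mul_div, le_div_iff₀ hσ]
      linarith
  have hμ := p.μ₁_mem.1
  calc _ ≤ D * ‖y - x‖ * ‖y - xs‖ := h3
    _ ≤ D * ‖y - x‖ * (2 * D / σ * ‖y - x‖) := by gcongr
    _ = 2 * D ^ 2 / σ * ‖y - x‖ ^ 2 := by ring
    _ ≤ 2 * D ^ 2 / σ * (p.γ₁ / p.μ₁ * (P.f x - P.f y)) := by
        gcongr
        rw [div_mul_eq_mul_div, le_div_iff₀ hμ]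
        linarith
    _ = _ := by ring

/-! ### Minimization steps on a face. -/

theorem MinStep.mem_feasible (h : P.MinStep x v y) (hx : x ∈ P.feasible) : y ∈ P.feasible := by
  by_cases hv : x + v ∈ P.feasible
  · exact h.2.1 hv ▸ hv
  · obtain ⟨α, -, rfl⟩ := h.2.2 hv
    exact (metricProj_spec (S := P.feasible ∩ P.face x) ⟨x, hx, hx.1, fun _ _ => rfl⟩
      (P.isClosed_feasible.inter (P.isClosed_face x))
      (P.convex_feasible.inter (P.convex_face x)) _).1.1

/-- If `y` is close to `x`, then the bounds active at `y` are active
at `x`. -/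
theorem eventually_active_subset (P : SLBQP n) (x : EuclideanSpace ℝ (Fin n)) :
    ∀ᶠ y in 𝓝 x, P.activeLower y ⊆ P.activeLower x ∧ P.activeUpper y ⊆ P.activeUpper x := by
  have hc : ∀ i, Tendsto (fun y : EuclideanSpace ℝ (Fin n) => (y i : EReal)) (𝓝 x) (𝓝 (x i)) :=
    fun i => (continuous_coe_real_ereal.comp (by fun_prop)).tendsto x
  have key : ∀ (b : Fin n → EReal), ∀ᶠ y : EuclideanSpace ℝ (Fin n) in 𝓝 x,
      ∀ i, (y i : EReal) = b i → (x i : EReal) = b i := by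
    intro b
    refine eventually_all.2 fun i => ?_
    by_cases hi : (x i : EReal) = b i
    · exact Eventually.of_forall fun _ _ => hi
    · filter_upwards [(hc i).eventually_ne hi] with y hy h using (hy h).elim
  filter_upwards [key P.l, key P.u] with y h1 h2
  exact ⟨fun i => h1 i, fun i => h2 i⟩

/-- Used with `x = x*` and `y` a late iterate, to place `x*` in the affine hull of the face of `y`.
-/
theorem sub_mem_faceDir (hx : inner ℝ P.q x = P.b) (hy : inner ℝ P.q y = P.b)
    (hl : P.activeLower y ⊆ P.activeLower x) (hu : P.activeUpper y ⊆ P.activeUpper x) :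
    x - y ∈ P.faceDir y := by
  refine ⟨inner_q_sub hy hx, ?_⟩
  rintro i (hi | hi)
  · have : (x i : EReal) = y i := (hl hi).trans hi.symm
    simpa [sub_eq_zero] using this
  · have : (x i : EReal) = y i := (hu hi).trans hi.symm
    simpa [sub_eq_zero] using this

theorem StrictlyConvex.strictConvexOn_faceDir (hconv : P.StrictlyConvex) (hx : x ∈ P.feasible) :
    StrictConvexOn ℝ (P.faceDir x) fun v => P.f (x + v) := by
  refine ⟨P.convex_faceDir x, fun v hv w hw hvw s t hs ht hst => ?_⟩
  have hmem : ∀ v ∈ P.faceDir x, x + v ∈ {x | inner ℝ P.q x = P.b} := fun v hv => by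
    simp only [Set.mem_ofPred_eq, inner_add_right, hv.1, hx.1, add_zero]
  have := hconv.2 (hmem v hv) (hmem w hw) (by simpa using hvw) hs ht hst
  rwa [smul_add, smul_add, add_add_add_comm, ← add_smul, hst, one_smul] at this

/-- If the optimal solution lies in the affine closure of the face of `x` and its gradient is
orthogonal to that face, then the exact minimization step leads to it. -/
theorem IsOptimal.eq_add_of_isMinOn (hconv : P.StrictlyConvex) (hopt : P.IsOptimal xs)
    (hmem : xs - x ∈ P.faceDir x) (horth : ∀ v ∈ P.faceDir x, inner ℝ (P.grad xs) v = 0)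
    (hv : v ∈ P.faceDir x) (hmin : IsMinOn (fun v => P.f (x + v)) (P.faceDir x) v) :
    x + v = xs := by
  by_contra hne
  have h1 := isMinOn_iff.1 hmin _ hmem
  have hw : x + v - xs ∈ P.faceDir x := by
    rw [show x + v - xs = v + -(xs - x) by abel]
    exact add_mem_faceDir hv (neg_mem_faceDir hmem)
  -- The linear term at `x*` vanishes along the face, so positive curvature makes any other point of
  -- its affine hull strictly worse.
  have h2 := hconv.inner_hess_pos hopt.1 hw.1 (sub_ne_zero.2 hne)
  have h3 := horth _ hw
  simp only [add_sub_cancel] at h1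
  rw [P.f_eq xs (x + v)] at h1
  linarith

/-! ### Invariants and convergence of a run. -/

section Run

variable {p : P2GPParams} {x d : ℕ → EuclideanSpace ℝ (Fin n)} {phase : ℕ → P2GPPhase} {k : ℕ}

/-- What is known at an iterate in terms of the phase that the method has reached. -/
def PhaseInvariant (P : SLBQP n) (xs : EuclideanSpace ℝ (Fin n)) (x : EuclideanSpace ℝ (Fin n))
    (k : ℕ) : P2GPPhase → Prop
  | .converged => x ∈ P.feasible ∧ x = xs
  | .unbounded => False
  | .identification m => x ∈ P.feasible ∧ x ≠ xs ∧ m ≤ k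
  | .minimization => x ∈ P.feasible ∧ x ≠ xs

theorem PhaseInvariant.mem_feasible {x : EuclideanSpace ℝ (Fin n)} {ph : P2GPPhase}
    (h : P.PhaseInvariant xs x k ph) : x ∈ P.feasible := by
  cases ph <;> first | exact h.1 | exact h.elim

theorem eq_zero_of_inner_hess_nonpos (hconv : P.StrictlyConvex) (hopt : P.IsOptimal xs)
    (hv : inner ℝ P.q v = 0) (h : inner ℝ v (P.hess v) ≤ 0) : v = 0 := by
  by_contra hne
  exact (hconv.inner_hess_pos hopt.1 hv hne).not_ge h

/-- An identification step of a run cannot detect unboundedness. -/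
theorem P2GPIter.identification (hconv : P.StrictlyConvex) (hopt : P.IsOptimal xs)
    (hx : x k ∈ P.feasible) (hne : x k ≠ xs) {m : ℕ} (hph : phase k = .identification m)
    (h : P.P2GPIter p x d phase k) :
    P.GPStep p (x k) (x (k + 1)) ∧ ((P.Conv p (x (k + 1)) ∧ phase (k + 1) = .converged) ∨
      (¬ P.Conv p (x (k + 1)) ∧ (phase (k + 1) = .minimization ∨
        (phase (k + 1) = .identification m ∧ ∀ j, m ≤ j → j < k →
          p.η * (P.f (x j) - P.f (x (j + 1))) < P.f (x k) - P.f (x (k + 1)))))) := by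
  simp only [P2GPIter, hph] at h
  rw [if_neg] at h
  · refine ⟨h.1, ?_⟩
    have h2 := h.2
    split_ifs at h2 with h3 h4
    · exact Or.inl ⟨h3, h2⟩
    · exact Or.inr ⟨h3, Or.inr ⟨h2, h4.2⟩⟩
    · exact Or.inr ⟨h3, Or.inl h2⟩
  · rintro ⟨h0, -⟩
    exact hne ((hopt.projGrad_eq_zero_iff hconv hx).1
      (eq_zero_of_inner_hess_nonpos hconv hopt projGrad_mem.1 h0))

/-- A minimization step of a run cannot detect unboundedness. -/
theorem P2GPIter.minimization (hconv : P.StrictlyConvex) (hopt : P.IsOptimal xs)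
    (hph : phase k = .minimization) (h : P.P2GPIter p x d phase k) :
    ((d k = 0 ∧ x (k + 1) = x k) ∨ P.MinStep (x k) (d k) (x (k + 1))) ∧
      ((P.Conv p (x (k + 1)) ∧ phase (k + 1) = .converged) ∨
      (¬ P.Conv p (x (k + 1)) ∧ (phase (k + 1) = .minimization ∨
        phase (k + 1) = .identification (k + 1)))) := by
  simp only [P2GPIter, hph] at h
  obtain ⟨hd, h⟩ := h
  split_ifs at h with h1 h2 h3 h3 h4
  · exact (h2.1 (eq_zero_of_inner_hess_nonpos hconv hopt hd.1 h1)).elim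
  all_goals try
    (have hd0 := eq_zero_of_inner_hess_nonpos hconv hopt hd.1 h1
     obtain ⟨⟨α, -, hx⟩, hp⟩ := h
     rw [hd0, smul_zero, add_zero] at hx)
  · exact ⟨Or.inl ⟨hd0, hx⟩, Or.inl ⟨h3, hp⟩⟩
  · exact ⟨Or.inl ⟨hd0, hx⟩, Or.inr ⟨h3, Or.inr hp⟩⟩
  · exact ⟨Or.inr h.1, Or.inl ⟨h3, h.2⟩⟩
  · exact ⟨Or.inr h.1, Or.inr ⟨h3, Or.inl h.2⟩⟩
  · exact ⟨Or.inr h.1, Or.inr ⟨h3, Or.inr h.2⟩⟩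

/-- The stopping test is exact, so the iterate differs from `x*` until convergence is declared; then
a nonpositive-curvature projected gradient or direction `d` must vanish or contradict this, and the
unbounded phase is unreachable. -/
theorem IsP2GPRun.phaseInvariant (htol : p.tol = 0) (hconv : P.StrictlyConvex)
    (hopt : P.IsOptimal xs) (hrun : P.IsP2GPRun p x d phase) (k : ℕ) :
    P.PhaseInvariant xs (x k) k (phase k) := by
  induction k with
  | zero =>
    have h0 := hrun.start_mem
    rw [hrun.start_phase]
    split_ifs with h
    · exact ⟨h0, (hopt.conv_iff htol hconv h0).1 h⟩
    · exact ⟨h0, fun he => h ((hopt.conv_iff htol hconv h0).2 he), le_rfl⟩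
  | succ k ih =>
    have hit := hrun.iter k
    rcases hph : phase k with m | _ | _ | _ <;> rw [hph] at ih
    · obtain ⟨hstep, h⟩ := hit.identification hconv hopt ih.1 ih.2.1 hph
      have hmem := hstep.mem_feasible ih.1
      rw [hopt.conv_iff htol hconv hmem] at h
      rcases h with ⟨h1, h2⟩ | ⟨h1, h2 | ⟨h2, -⟩⟩ <;> rw [h2]
      exacts [⟨hmem, h1⟩, ⟨hmem, h1⟩, ⟨hmem, h1, ih.2.2.trans k.le_succ⟩]
    · obtain ⟨hstep, h⟩ := hit.minimization hconv hopt hph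
      have hmem : x (k + 1) ∈ P.feasible := by
        rcases hstep with ⟨-, h⟩ | h
        · exact h ▸ ih.1
        · exact h.mem_feasible ih.1
      rw [hopt.conv_iff htol hconv hmem] at h
      rcases h with ⟨h1, h2⟩ | ⟨h1, h2 | h2⟩ <;> rw [h2]
      exacts [⟨hmem, h1⟩, ⟨hmem, h1⟩, ⟨hmem, h1, le_rfl⟩]
    · simp only [P2GPIter, hph] at hit
      rw [hit.1, hit.2]
      exact ih
    · exact ih.elim

theorem IsP2GPRun.eventually_eq_of_converged (htol : p.tol = 0) (hconv : P.StrictlyConvex)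
    (hopt : P.IsOptimal xs) (hrun : P.IsP2GPRun p x d phase) (h : phase k = .converged) :
    ∀ j, k ≤ j → x j = xs := by
  intro j hj
  have hph : phase j = .converged := by
    induction j, hj using Nat.le_induction with
    | base => exact h
    | succ j _ ih =>
      have := hrun.iter j
      simp only [P2GPIter, ih] at this
      exact this.2
  have := hrun.phaseInvariant htol hconv hopt j
  rw [hph] at this
  exact this.2

theorem IsP2GPRun.antitone_f (htol : p.tol = 0) (hconv : P.StrictlyConvex)
    (hopt : P.IsOptimal xs) (hrun : P.IsP2GPRun p x d phase) : Antitone fun k => P.f (x k) := by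
  refine antitone_nat_of_succ_le fun k => ?_
  have hit := hrun.iter k
  have hinv := hrun.phaseInvariant htol hconv hopt k
  rcases hph : phase k with m | _ | _ | _ <;> rw [hph] at hinv
  · exact (hit.identification hconv hopt hinv.1 hinv.2.1 hph).1.f_le hinv.1
  · rcases (hit.minimization hconv hopt hph).1 with ⟨-, h⟩ | h
    · rw [h]
    · exact h.1.le
  · simp only [P2GPIter, hph] at hit
    rw [hit.1]
  · exact hinv.elim

/-- Only GP steps need to contract the gap; every other step merely must not increase it. -/
theorem IsP2GPRun.tendsto_f (htol : p.tol = 0) (hconv : P.StrictlyConvex)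
    (hopt : P.IsOptimal xs) (hrun : P.IsP2GPRun p x d phase)
    (hGP : (gpIterations phase).Infinite) :
    Tendsto (fun k => P.f (x k) - P.f xs) atTop (𝓝 0) := by
  obtain ⟨C, hC⟩ := exists_gap_le_decrease hconv hopt p
  have hanti := hrun.antitone_f htol hconv hopt
  refine tendsto_zero_of_frequently_le_decrease (C := C)
    (fun i j hij => sub_le_sub_right (hanti hij) _) (fun k => ?_) ?_
  · exact sub_nonneg.2 (isMinOn_iff.1 hopt.2 _ (hrun.phaseInvariant htol hconv hopt k).mem_feasible)
  · refine (Nat.frequently_atTop_iff_infinite.2 hGP).mono ?_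
    rintro k ⟨m, hph⟩
    have hinv := hrun.phaseInvariant htol hconv hopt k
    rw [hph] at hinv
    have := hC _ _ hinv.1 ((hrun.iter k).identification hconv hopt hinv.1 hinv.2.1 hph).1
    simpa using this

theorem IsP2GPRun.tendsto (htol : p.tol = 0) (hconv : P.StrictlyConvex)
    (hopt : P.IsOptimal xs) (hrun : P.IsP2GPRun p x d phase)
    (hGP : (gpIterations phase).Infinite) : Tendsto x atTop (𝓝 xs) := by
  obtain ⟨σ, hσ, hσle⟩ := hconv.exists_le_inner_hess hopt.1
  have h1 : Tendsto (fun k => ‖x k - xs‖ ^ 2) atTop (𝓝 0) := by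
    refine squeeze_zero (fun _ => sq_nonneg _) (fun k => ?_)
      (by simpa using (hrun.tendsto_f htol hconv hopt hGP).const_mul (2 / σ))
    have := hopt.le_f_sub hσle (hrun.phaseInvariant htol hconv hopt k).mem_feasible
    rw [div_mul_eq_mul_div, le_div_iff₀ hσ]
    linarith
  rw [tendsto_iff_norm_sub_tendsto_zero]
  simpa using h1.sqrt

/-! ### Identification of the optimal face and finite termination. -/

/-- The gradient at the solution is eventually orthogonal to the faces reached by the gradient
projection steps. -/
theorem IsP2GPRun.eventually_inner_grad_eq_zero (htol : p.tol = 0) (hconv : P.StrictlyConvex)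
    (hopt : P.IsOptimal xs) (hrun : P.IsP2GPRun p x d phase)
    (hGP : (gpIterations phase).Infinite) :
    ∀ᶠ k in atTop, k ∈ gpIterations phase →
      ∀ v ∈ P.faceDir (x (k + 1)), inner ℝ (P.grad xs) v = 0 := by
  obtain ⟨a, ha, H⟩ := exists_le_steplength P p
  have hlim := hrun.tendsto htol hconv hopt hGP
  -- The active set is fixed first, so that a violating direction `v` does not depend on `k`;
  -- finiteness of the collection of sets `A` then gives a common threshold.
  have key : ∀ A : Set (Fin n), ∀ᶠ k in atTop, k ∈ gpIterations phase → P.active (x (k + 1)) = A →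
      ∀ v : EuclideanSpace ℝ (Fin n), inner ℝ P.q v = 0 → (∀ i ∈ A, v i = 0) →
        inner ℝ (P.grad xs) v = 0 := by
    intro A
    by_cases hA : ∀ v : EuclideanSpace ℝ (Fin n), inner ℝ P.q v = 0 → (∀ i ∈ A, v i = 0) →
        inner ℝ (P.grad xs) v = 0
    · exact Eventually.of_forall fun _ _ _ => hA
    · push Not at hA
      obtain ⟨v, hqv, hvA, hv⟩ := hA
      have h1 : Tendsto (fun k => |inner ℝ (P.grad xs) v| - |inner ℝ (P.grad (x k)) v|) atTop
          (𝓝 0) := by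
        have : Tendsto (fun k => inner ℝ (P.grad (x k)) v) atTop (𝓝 (inner ℝ (P.grad xs) v)) :=
          ((P.continuous_grad.tendsto xs).comp hlim).inner tendsto_const_nhds
        simpa using this.abs.const_sub |inner ℝ (P.grad xs) v|
      have h2 : Tendsto (fun k => ‖x k - x (k + 1)‖ * ‖v‖ / a) atTop (𝓝 0) := by
        simpa using
          ((hlim.sub ((tendsto_add_atTop_iff_nat 1).2 hlim)).norm.mul_const ‖v‖).div_const a
      have h3 := (h1.add h2).eventually (gt_mem_nhds (by simpa using hv :
        (0 : ℝ) + 0 < |inner ℝ (P.grad xs) v|))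
      filter_upwards [h3] with k hk
      rintro ⟨m, hph⟩ hact
      exfalso
      have hinv := hrun.phaseInvariant htol hconv hopt k
      rw [hph] at hinv
      obtain ⟨α, haα, -, hy, -⟩ := H _ _ hinv.1
        ((hrun.iter k).identification hconv hopt hinv.1 hinv.2.1 hph).1
      have hα := ha.trans_le haα
      have hvf : v ∈ P.faceDir (P.gpArc (x k) α) := ⟨hqv, by rw [← hy, hact]; exact hvA⟩
      have h4 := inner_grad_eq_of_mem_faceDir_gpArc hinv.1 hvf
      rw [← hy] at h4
      have h5 : |inner ℝ (P.grad (x k)) v| ≤ ‖x k - x (k + 1)‖ * ‖v‖ / a := by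
        rw [le_div_iff₀ ha]
        calc _ ≤ |inner ℝ (P.grad (x k)) v| * α := by gcongr
          _ = |α * inner ℝ (P.grad (x k)) v| := by rw [abs_mul, abs_of_pos hα, mul_comm]
          _ ≤ _ := by rw [h4]; exact abs_real_inner_le_norm _ _
      linarith
  filter_upwards [eventually_all.2 key] with k hk hGPk v hv
  exact hk _ hGPk rfl v hv.1 hv.2

/-- An identification phase of a run that goes on for ever is followed by a minimization phase. -/
theorem IsP2GPRun.exists_minimization (htol : p.tol = 0) (hconv : P.StrictlyConvex)
    (hopt : P.IsOptimal xs) (hrun : P.IsP2GPRun p x d phase) (hinfinite : ¬ Stops phase)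
    (hGP : (gpIterations phase).Infinite) {K : ℕ} (hK : K ∈ gpIterations phase) :
    ∃ k, K ≤ k ∧ k ∈ gpIterations phase ∧ phase (k + 1) = .minimization := by
  by_contra! hcon
  obtain ⟨m, hm⟩ := hK
  have hstep : ∀ j, phase j = .identification m → P.GPStep p (x j) (x (j + 1)) ∧
      ((P.Conv p (x (j + 1)) ∧ phase (j + 1) = .converged) ∨
      (¬ P.Conv p (x (j + 1)) ∧ (phase (j + 1) = .minimization ∨
        (phase (j + 1) = .identification m ∧ ∀ i, m ≤ i → i < j →
          p.η * (P.f (x i) - P.f (x (i + 1))) < P.f (x j) - P.f (x (j + 1)))))) := fun j hj => by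
    have hinv := hrun.phaseInvariant htol hconv hopt j
    rw [hj] at hinv
    exact (hrun.iter j).identification hconv hopt hinv.1 hinv.2.1 hj
  have hnext : ∀ j, K ≤ j → phase j = .identification m → phase (j + 1) = .identification m ∧
      ∀ i, m ≤ i → i < j →
        p.η * (P.f (x i) - P.f (x (i + 1))) < P.f (x j) - P.f (x (j + 1)) := fun j hj hph => by
    rcases (hstep j hph).2 with ⟨-, h⟩ | ⟨-, h | h⟩
    · exact (hinfinite ⟨_, Or.inl h⟩).elim
    · exact (hcon j hj ⟨m, hph⟩ h).elim
    · exact h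
  have hall : ∀ j, K ≤ j → phase j = .identification m := fun j hj => by
    induction j, hj using Nat.le_induction with
    | base => exact hm
    | succ j hj ih => exact (hnext j hj ih).1
  have hinv := hrun.phaseInvariant htol hconv hopt K
  -- The invariant supplies `m ≤ K`, so iteration `K` is among those with which later decreases in
  -- the phase are compared.
  rw [hm] at hinv
  have hpos := sub_pos.2 ((hstep K hm).1.f_lt hconv hopt hinv.1 hinv.2.1)
  have hlim := hrun.tendsto_f htol hconv hopt hGP
  have hdiff : Tendsto (fun k => P.f (x k) - P.f (x (k + 1))) atTop (𝓝 0) := by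
    simpa using hlim.sub ((tendsto_add_atTop_iff_nat 1).2 hlim)
  obtain ⟨j, hj1, hj2⟩ := ((hdiff.eventually (gt_mem_nhds (mul_pos p.η_mem.1 hpos))).and
    (eventually_gt_atTop K)).exists
  exact lt_asymm hj1 ((hnext j hj2.le (hall j hj2.le)).2 K hinv.2.2 hj2)

theorem IsP2GPRun.stops (htol : p.tol = 0) (hconv : P.StrictlyConvex)
    (hopt : P.IsOptimal xs) (hrun : P.IsP2GPRun p x d phase)
    (hexact : P.ExactMinimization x d phase) (hGP : (gpIterations phase).Infinite) :
    Stops phase := by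
  by_contra hinfinite
  have hlim := hrun.tendsto htol hconv hopt hGP
  have hact := ((tendsto_add_atTop_iff_nat 1).2 hlim).eventually (P.eventually_active_subset xs)
  obtain ⟨K₀, hK₀⟩ := eventually_atTop.1
    ((hrun.eventually_inner_grad_eq_zero htol hconv hopt hGP).and hact)
  obtain ⟨K, hK, hKK₀⟩ := hGP.exists_gt K₀
  -- Here `k` is the last GP iteration of its phase: the point `x (k + 1)` it produces is where the
  -- exact minimization starts.
  obtain ⟨k, hk, hkGP, hph⟩ := hrun.exists_minimization htol hconv hopt hinfinite hGP hK
  obtain ⟨horth, hl, hu⟩ := hK₀ k (hKK₀.le.trans hk)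
  have hinv := hrun.phaseInvariant htol hconv hopt (k + 1)
  rw [hph] at hinv
  obtain ⟨hd, hmin⟩ := hexact _ hph (hconv.strictConvexOn_faceDir hinv.1)
  have hxs := hopt.eq_add_of_isMinOn hconv (sub_mem_faceDir hopt.1.1 hinv.1.1 hl hu)
    (horth hkGP) hd hmin
  obtain ⟨⟨hd0, -⟩ | hstep, h⟩ := (hrun.iter (k + 1)).minimization hconv hopt hph
  · exact hinv.2 (by rw [← hxs, hd0, add_zero])
  · have hnext : x (k + 1 + 1) = xs := by
      -- The full step ends at `x*`, which is feasible, so no projected step is taken.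
      rw [hstep.2.1 (by rw [hxs]; exact hopt.1), hxs]
    rcases h with ⟨-, h⟩ | ⟨h, -⟩
    · exact hinfinite ⟨_, Or.inl h⟩
    · exact h ((hopt.conv_iff htol hconv (hnext ▸ hopt.1)).2 hnext)

end Run

end SLBQP

theorem mainTheorem1 {n m : ℕ} (P : SLBQP n) (p : P2GPParams)
    (V : Matrix (Fin n) (Fin m) ℝ) (hV : P.IsNullBasis V)
    (hconv : P.StrictlyConvex)
    (xstar : EuclideanSpace ℝ (Fin n)) (hopt : P.IsOptimal xstar)
    (x d : ℕ → EuclideanSpace ℝ (Fin n)) (phase : ℕ → P2GPPhase)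
    (hrun : P.IsP2GPRun p x d phase)
    (htol : p.tol = 0)
    (hexact : P.ExactMinimization x d phase)
    (hGP : Stops phase ∨ (gpIterations phase).Infinite)
    (hcase : P.Nondegenerate xstar ∨
      (¬ P.Nondegenerate xstar ∧ Real.sqrt (condNumber (P.reducedHessian V)) ≤ p.Γ)) :
    ∃ K : ℕ, ∀ k, K ≤ k → x k = xstar := by
  obtain ⟨k, hk | hk⟩ : Stops phase :=
    hGP.elim id (hrun.stops htol hconv hopt hexact)
  · exact ⟨k, hrun.eventually_eq_of_converged htol hconv hopt hk⟩
  · have := hrun.phaseInvariant htol hconv hopt k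
    rw [hk] at this
    exact this.elim
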